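/- All graphs are finite multigraphs: multiple edges are allowed, loops are not. For such a graph $G$ on a vertex set $V$ with $n$ elements, let $\Lambda_G=D-A\in\mathbb{Z}^{V\times V}$ be its Laplacian matrix, where $A_{ij}$ is the number of edges between $i$ and $j$ and $D$ is the diagonal matrix of the vertex degrees. For $S\subseteq V$ let $b_S(G)\in\mathbb{Z}^V$ be the sum of the rows of $\Lambda_G$ indexed by the elements of $S$. Let $\Pi=\{V_1,\dots,V_k\}$ be a partition of $V$ into nonempty sets. The pair $(G,\Pi)$ is a pseudo-pargraph if $G$ is connected, and it is a pargraph if moreover each induced subgraph $G[V_i]$ is connected. The Laplacian lattice $L_\Pi(G)$ is the subgroup of $\mathbb{Z}^V$ generated by $b_{V_1}(G),\dots,b_{V_k}(G)$, and the Picard group of $(G,\Pi)$ is $\mathbb{Z}^V/L_\Pi(G)$. Two such pairs $(G,\Pi)$ and $(G_1,\Pi)$ with $V(G_1)=V(G)=V$ are said to have the same Laplacian lattice if $b_{V_t}(G_1)=b_{V_t}(G)$ for all $1\le t\le k$. Lemma. Let $(G,\Pi)$ be a pargraph and let $(G_1,\Pi)$ be a pseudo-pargraph with $V(G_1)=V(G)$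 such that $(G,\Pi)$ and $(G_1,\Pi)$ have the same Laplacian lattice. If the numbers of spanning trees of $G$ and of $G_1$ are relatively prime, then the Picard group of $(G,\Pi)$ is a free abelian group. -/

import Mathlib

namespace Graph

open scoped Graph

/-- A multigraph is connected if it has a vertex and any two of its vertices are joined by a walk,
that is, if its underlying simple graph is connected. -/
def IsConnected {α β : Type*} (G : Graph α β) : Prop :=
  G.toSimpleGraph.Connected

/-- A multigraph is a tree if it has neither loops nor parallel edges and, as a simple graph, it is
connected and has no cycles. -/
def IsTree {α β : Type*} (G : Graph α β) : Prop :=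
  G.Simple ∧ G.toSimpleGraph.IsTree

/-- The set of spanning trees of `G`: the subgraphs with the vertex set of `G` that are trees.
Trees that differ in their choice among parallel edges are different elements. -/
def spanningTrees {α β : Type*} (G : Graph α β) : Set (Graph α β) :=
  {T | T ≤s G ∧ T.IsTree}

/-- The total number of spanning trees of a finite multigraph. -/
noncomputable def numSpanningTrees {α β : Type*} (G : Graph α β) : ℕ :=
  G.spanningTrees.ncard

/-- The adjacency matrix: the `(i, j)` entry is the number of edges between `i` and `j`. -/
noncomputable def adjacencyMatrix {V E : Type*} (G : Graph V E) : Matrix V V ℤ :=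
  Matrix.of fun i j => ({e | G.IsLink e i j}.ncard : ℤ)

/-- The valence of a vertex: the number of edges incident with it (used for loopless graphs). -/
noncomputable def valence {V E : Type*} (G : Graph V E) (i : V) : ℕ :=
  (G.incidenceSet i).ncard

/-- The Laplacian matrix `D - A`. -/
noncomputable def laplacianMatrix {V E : Type*} [DecidableEq V] (G : Graph V E) : Matrix V V ℤ :=
  Matrix.diagonal (fun i => (G.valence i : ℤ)) - G.adjacencyMatrix

/-- `(G, P)` is a pseudo-pargraph: `G` is a finite connected multigraph without loops on the
vertex set `V`, and `P` is a partition of `V` (into nonempty sets, with no condition on the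
subgraphs which these induce). -/
structure IsPseudoPargraph {V E : Type*} [Fintype V] [DecidableEq V] (G : Graph V E)
    (P : Finpartition (Finset.univ : Finset V)) : Prop where
  vertexSet_eq : V(G) = Set.univ
  finite_edgeSet : E(G).Finite
  loopless : G.Loopless
  connected : G.IsConnected

/-- `(G, P)` is a pargraph: a pseudo-pargraph in which every part of `P` induces a connected
subgraph of `G`. -/
structure IsPargraph {V E : Type*} [Fintype V] [DecidableEq V] (G : Graph V E)
    (P : Finpartition (Finset.univ : Finset V)) : Prop extends IsPseudoPargraph G P where
  connected_induce : ∀ S ∈ P.parts, (G.induce (S : Set V)).IsConnected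

/-- The firing vector `b_S`: the sum of the rows of the Laplacian matrix over the vertices
of `S`. -/
noncomputable def firingVector {V E : Type*} [DecidableEq V] (G : Graph V E) (S : Finset V) :
    V → ℤ :=
  ∑ j ∈ S, G.laplacianMatrix j

/-- The Laplacian lattice of `(G, P)`: the subgroup of `ℤ^V` generated by the vectors `b_S`, where
`S` runs over the parts of `P`. -/
noncomputable def laplacianLattice {V E : Type*} [Fintype V] [DecidableEq V] (G : Graph V E)
    (P : Finpartition (Finset.univ : Finset V)) : AddSubgroup (V → ℤ) :=
  AddSubgroup.closure {b | ∃ S ∈ P.parts, b = G.firingVector S}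

/-- The Picard group of `(G, P)`: the quotient of `ℤ^V` by the Laplacian lattice. -/
abbrev PicardGroup {V E : Type*} [Fintype V] [DecidableEq V] (G : Graph V E)
    (P : Finpartition (Finset.univ : Finset V)) : Type _ :=
  (V → ℤ) ⧸ G.laplacianLattice P

/-- `(G, P)` and `(G₁, P)` have the same Laplacian lattice in the sense that the distinguished
generators agree: `b_S` is the same vector for `G` and for `G₁`, for every part `S` of `P`. -/
def SameLaplacianLattice {V E E₁ : Type*} [Fintype V] [DecidableEq V] (G : Graph V E)
    (G₁ : Graph V E₁) (P : Finpartition (Finset.univ : Finset V)) : Prop :=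
  ∀ S ∈ P.parts, G₁.firingVector S = G.firingVector S

end Graph

/-! The Picard group is finitely generated, so it suffices that it has no torsion. Suppose `n • x`
is an integer combination of the vectors `b_S`; as a row equation this reads `f Λ = n x` with `f`
constant on parts. The rows of `Λ` sum to zero, so `f` may be shifted to vanish at a chosen root
`r`. Deleting the row and column of `r` and multiplying by the adjugate gives `n ∣ τ(G) f`, where
the determinant `τ(G)` counts spanning trees (`dvd_numSpanningTrees_mul`). The same `f` solves the
equation for `G₁`, so `n ∣ τ(G₁) f`; coprimality gives `n ∣ f`, and `f / n` exhibits `x` in the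
lattice.

The matrix-tree theorem is proved by expanding the reduced determinant over choices of one edge at
each non-root vertex. A choice contributes 1 if following the edges leads to `r`, and 0 otherwise;
the former choices are the spanning trees oriented towards `r`. -/

namespace Graph

open Finset Matrix

/-! ### Parent maps and their determinants -/

section Rooted

variable {V : Type*} {r : V}

/-- A parent map, defined off the root, is rooted if following parents strictly decreases some
height function. -/
def IsRooted (φ : {i : V // i ≠ r} → V) : Prop :=
  ∃ h : V → ℕ, ∀ i, h (φ i) < h i

lemma IsRooted.induction {φ : {i : V // i ≠ r} → V} (hφ : IsRooted φ) {p : V → Prop}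
    (root : p r) (step : ∀ i, p (φ i) → p i) (i : V) : p i := by
  obtain ⟨h, hh⟩ := hφ
  induction hn : h i using Nat.strong_induction_on generalizing i with
  | _ n ih =>
    by_cases hi : i = r
    · exact hi ▸ root
    · exact step ⟨i, hi⟩ (ih _ (hn ▸ hh ⟨i, hi⟩) _ rfl)

variable [DecidableEq V]

/-- Iterating the parent map, with the root fixed. -/
def ancestor (φ : {i : V // i ≠ r} → V) (i : V) : V :=
  if hi : i ≠ r then φ ⟨i, hi⟩ else r

lemma isRooted_of_forall_reaches {φ : {i : V // i ≠ r} → V}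
    (H : ∀ i, ∃ n, (ancestor φ)^[n] i = r) : IsRooted φ := by
  classical
  refine ⟨fun i => Nat.find (H i), fun i => ?_⟩
  have h0 : Nat.find (H i) ≠ 0 := by
    intro h
    have := Nat.find_spec (H i)
    rw [h] at this
    exact i.2 this
  obtain ⟨m, hm⟩ := Nat.exists_eq_succ_of_ne_zero h0
  have hs := Nat.find_spec (H i)
  rw [hm, Function.iterate_succ_apply] at hs
  have : ancestor φ i = φ i := by simp [ancestor, i.2]
  rw [this] at hs
  change Nat.find (H (φ i)) < Nat.find (H i)
  rw [hm]
  exact Nat.lt_succ_of_le (Nat.find_min' _ hs)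

/-- The reduced Laplacian matrix of a parent map. -/
def parentMatrix (φ : {i : V // i ≠ r} → V) : Matrix {i : V // i ≠ r} {i : V // i ≠ r} ℤ :=
  of fun i j => (if (i : V) = j then 1 else 0) - if φ i = j then 1 else 0

/-- Off the diagonal, row `i` is supported at the parent, which is strictly lower; grouping by
height gives a block triangular matrix with identity blocks. -/
lemma det_parentMatrix_of_isRooted [Fintype V] {φ : {i : V // i ≠ r} → V} (hφ : IsRooted φ) :
    (parentMatrix φ).det = 1 := by
  obtain ⟨h, hh⟩ := hφ
  have hb : BlockTriangular (parentMatrix φ) (fun i => OrderDual.toDual (h i)) := by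
    intro i j hij
    have hij' : h i < h j := hij
    have h1 : (i : V) ≠ j := fun e => by simp [e] at hij'
    have h2 : φ i ≠ j := fun e => by have := hh i; rw [e] at this; omega
    simp [parentMatrix, h1, h2]
  rw [hb.det]
  refine prod_eq_one fun k _ => ?_
  have : (parentMatrix φ).toSquareBlock (fun i => OrderDual.toDual (h i)) k = 1 := by
    ext ⟨i, hi⟩ ⟨j, hj⟩
    have hij : h i = h j := by
      have := hi.trans hj.symm
      simpa using this
    have h2 : φ i ≠ j := fun e => by have := hh i; rw [e] at this; omega
    simp [toSquareBlock_def, parentMatrix, h2, Matrix.one_apply, Subtype.ext_iff]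
  rw [this, det_one]

lemma det_parentMatrix_of_not_isRooted [Fintype V] {φ : {i : V // i ≠ r} → V}
    (hφ : ¬ IsRooted φ) : (parentMatrix φ).det = 0 := by
  classical
  -- The indicator of the vertices that never reach the root is constant along the parent map, hence
  -- a kernel vector.
  let x : V → ℤ := fun i => if ∃ n, (ancestor φ)^[n] i = r then 0 else 1
  have hxr : x r = 0 := if_pos ⟨0, rfl⟩
  have hx (i : {i : V // i ≠ r}) : x (φ i) = x i := by
    have ha : ancestor φ i = φ i := by simp [ancestor, i.2]
    have : (∃ n, (ancestor φ)^[n] (φ i) = r) ↔ ∃ n, (ancestor φ)^[n] (i : V) = r := by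
      constructor
      · rintro ⟨n, hn⟩
        exact ⟨n + 1, by rwa [Function.iterate_succ_apply, ha]⟩
      · rintro ⟨_ | n, hn⟩
        · exact absurd hn i.2
        · exact ⟨n, by rwa [Function.iterate_succ_apply, ha] at hn⟩
    simp only [x, this]
  refine exists_mulVec_eq_zero_iff.1 ⟨fun i => x i, fun h0 => hφ ?_, ?_⟩
  · refine isRooted_of_forall_reaches fun i => ?_
    by_cases hi : i = r
    · exact ⟨0, hi⟩
    · by_contra hc
      have := congrFun h0 ⟨i, hi⟩
      simp [x, hc] at this
  · ext i
    have h1 : ∑ j : {i : V // i ≠ r}, (if (i : V) = j then x j else 0) = x i := by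
      rw [Finset.sum_eq_single i] <;> simp +contextual [Subtype.ext_iff, eq_comm]
    have h2 : ∑ j : {i : V // i ≠ r}, (if φ i = j then x j else 0) = x (φ i) := by
      by_cases hi : φ i = r
      · rw [hi, hxr]
        exact sum_eq_zero fun j _ => if_neg fun e => j.2 e.symm
      · rw [Finset.sum_eq_single ⟨φ i, hi⟩]
        · simp
        · intro j _ hj
          exact if_neg fun e => hj (Subtype.ext e.symm)
        · simp
    simp only [mulVec, dotProduct, parentMatrix, of_apply, sub_mul, sum_sub_distrib, ite_mul,
      one_mul, zero_mul, h1, h2, hx, sub_self, Pi.zero_apply]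

end Rooted

/-! ### Spanning trees as rooted edge choices, and the matrix-tree theorem -/

section MatrixTree

variable {V E : Type*} (G : Graph V E)

open Classical in
/-- The other end of an edge, with a default value at vertices off the edge. -/
noncomputable def otherEnd (e : E) (i : V) : V :=
  if h : G.Inc e i then h.other else i

variable {G}

lemma Inc.isLink_otherEnd {e : E} {i : V} (h : G.Inc e i) : G.IsLink e i (G.otherEnd e i) := by
  simp [otherEnd, h, h.isLink_other]

variable (G) in
/-- The choices of an edge at every vertex off the root `r` such that following the chosen edges
leads to `r`. -/
def rootedChoices (r : V) : Set ({i : V // i ≠ r} → E) :=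
  {c | (∀ i, G.Inc (c i) i) ∧ IsRooted fun i => G.otherEnd (c i) i}

section

variable {r : V} {c c' : {i : V // i ≠ r} → E}

lemma isLink_of_mem_rootedChoices (hc : c ∈ G.rootedChoices r) (i : {i : V // i ≠ r}) :
    G.IsLink (c i) i (G.otherEnd (c i) i) :=
  (hc.1 i).isLink_otherEnd

/-- An edge chosen from both of its ends would force the height to drop in both directions. -/
lemma eq_of_ends_eq_of_mem_rootedChoices (hc : c ∈ G.rootedChoices r) {i j : {i : V // i ≠ r}}
    {e : E} (hi : G.IsLink e i (G.otherEnd (c i) i)) (hj : G.IsLink e j (G.otherEnd (c j) j)) :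
    i = j := by
  obtain ⟨h, hh⟩ := hc.2
  rcases hi.eq_and_eq_or_eq_and_eq hj with ⟨h1, _⟩ | ⟨h1, h2⟩
  · exact Subtype.ext h1
  · have a := hh i
    have b := hh j
    simp only [h2, ← h1] at a b
    omega

lemma injective_of_mem_rootedChoices (hc : c ∈ G.rootedChoices r) : Function.Injective c := by
  intro i j hij
  exact eq_of_ends_eq_of_mem_rootedChoices hc (isLink_of_mem_rootedChoices hc i)
    (hij ▸ isLink_of_mem_rootedChoices hc j)

/-- Induct outwards from the root. If `c i = c' j`, then `j` is `i` or its parent under `c`; in the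
second case induction gives `c j = c' j = c i`, against injectivity of `c`. -/
lemma eq_of_range_subset_of_mem_rootedChoices (hc : c ∈ G.rootedChoices r)
    (hc' : c' ∈ G.rootedChoices r) (h : Set.range c ⊆ Set.range c') : c = c' := by
  have key : ∀ v, ∀ hv : v ≠ r, c ⟨v, hv⟩ = c' ⟨v, hv⟩ := by
    refine hc.2.induction (fun hv => absurd rfl hv) ?_
    intro i ih hi
    change c i = c' i
    obtain ⟨j, hj⟩ := h ⟨i, rfl⟩
    have hjl := (hc'.1 j)
    rw [hj] at hjl
    rcases hjl.eq_or_eq_of_isLink (isLink_of_mem_rootedChoices hc i) with h1 | h1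
    · rw [← hj, Subtype.ext h1]
    · have hne : G.otherEnd (c i) i ≠ r := h1 ▸ j.2
      have h2 := ih hne
      have h3 : (⟨G.otherEnd (c i) i, hne⟩ : {i : V // i ≠ r}) = j := Subtype.ext h1.symm
      rw [h3, hj] at h2
      have h4 := injective_of_mem_rootedChoices hc h2
      rw [← hj, h4]
  exact funext fun i => key i i.2

lemma restrict_range_mem_spanningTrees [Finite V] [hl : G.Loopless] (hV : V(G) = Set.univ)
    (hc : c ∈ G.rootedChoices r) :
    G.restrict (Set.range c) ∈ G.spanningTrees := by
  have mem (v : V) : v ∈ V(G.restrict (Set.range c)) := by simp [hV]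
  have hlink (i : {i : V // i ≠ r}) :
      (G.restrict (Set.range c)).IsLink (c i) i (G.otherEnd (c i) i) := by
    simp [isLink_of_mem_rootedChoices hc i]
  have hll : (G.restrict (Set.range c)).Loopless := hl.anti restrict_le
  have hfin : Finite V(G.restrict (Set.range c)) := inferInstance
  have hconn : (G.restrict (Set.range c)).toSimpleGraph.Connected := by
    have hr : ∀ v, (G.restrict (Set.range c)).toSimpleGraph.Reachable ⟨v, mem v⟩ ⟨r, mem r⟩ := by
      refine hc.2.induction (SimpleGraph.Reachable.refl _) fun i hi => ?_
      refine SimpleGraph.Reachable.trans (SimpleGraph.Adj.reachable ?_) hi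
      rw [toSimpleGraph_adj_iff]
      exact ⟨_, hlink i⟩
    have : Nonempty V(G.restrict (Set.range c)) := ⟨⟨r, mem r⟩⟩
    exact ⟨fun u v => (hr u).trans (hr v).symm⟩
  refine ⟨⟨restrict_le, rfl⟩, ⟨?_⟩, ?_⟩
  · rintro e f x y he hf
    rw [restrict_isLink] at he hf
    obtain ⟨i, rfl⟩ := he.1
    obtain ⟨j, rfl⟩ := hf.1
    have hi := isLink_of_mem_rootedChoices hc i
    have hj := isLink_of_mem_rootedChoices hc j
    have : G.IsLink (c i) j (G.otherEnd (c j) j) := by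
      rw [he.2.isLink_iff_sym2_eq, ← hf.2.isLink_iff_sym2_eq]
      exact hj
    rw [eq_of_ends_eq_of_mem_rootedChoices hc hi this]
  · rw [SimpleGraph.isTree_iff_connected_and_card]
    refine ⟨hconn, le_antisymm ?_ hconn.card_vert_le_card_edgeSet_add_one⟩
    have hcard : Nat.card V(G.restrict (Set.range c)) = Nat.card {i : V // i ≠ r} + 1 := by
      classical
      have := Fintype.ofFinite V
      rw [vertexSet_restrict, hV, Nat.card_congr (Equiv.Set.univ V), Nat.card_eq_fintype_card,
        Nat.card_eq_fintype_card, Fintype.card_subtype_compl, Fintype.card_subtype_eq]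
      have : 0 < Fintype.card V := Fintype.card_pos_iff.2 ⟨r⟩
      omega
    rw [hcard]
    gcongr
    have hsub : (G.restrict (Set.range c)).toSimpleGraph.edgeSet ⊆
        Set.range fun i : {i : V // i ≠ r} =>
          s(⟨i, mem i⟩, ⟨G.otherEnd (c i) i, mem _⟩) := by
      intro e
      induction e with
      | _ x y =>
        rw [SimpleGraph.mem_edgeSet, toSimpleGraph_adj_iff]
        rintro ⟨e, he⟩
        have he' := he
        rw [restrict_isLink] at he'
        obtain ⟨i, rfl⟩ := he'.1
        refine ⟨i, ?_⟩
        rcases (hlink i).eq_and_eq_or_eq_and_eq he with ⟨h1, h2⟩ | ⟨h1, h2⟩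
        · simp only [Sym2.eq_iff, Subtype.ext_iff]
          exact Or.inl ⟨h1, h2⟩
        · simp only [Sym2.eq_iff, Subtype.ext_iff]
          exact Or.inr ⟨h1, h2⟩
    exact (Nat.card_mono (Set.toFinite _) hsub).trans (Finite.card_range_le _)

lemma exists_rootedChoice_of_mem_spanningTrees (hV : V(G) = Set.univ) (r : V) {T : Graph V E}
    (hT : T ∈ G.spanningTrees) : ∃ c ∈ G.rootedChoices r, G.restrict (Set.range c) = T := by
  obtain ⟨hTG, hsimple, htree⟩ := hT
  have mem (v : V) : v ∈ V(T) := by simp [hTG.vertexSet_eq, hV]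
  -- Each vertex chooses the first edge of a shortest path to `r` in `T`, so distance serves as the
  -- height.
  let h : V → ℕ := fun v => T.toSimpleGraph.dist ⟨v, mem v⟩ ⟨r, mem r⟩
  have hstep (i : {i : V // i ≠ r}) : ∃ e w, T.IsLink e i w ∧ h w < h i := by
    obtain ⟨p, hp⟩ := (htree.connected ⟨i, mem i⟩ ⟨r, mem r⟩).exists_walk_length_eq_dist
    generalize hu : (⟨i, mem i⟩ : V(T)) = u at p hp
    generalize hz : (⟨r, mem r⟩ : V(T)) = z at p hp
    cases p with
    | nil => exact absurd (congrArg Subtype.val (hu.trans hz.symm)) i.2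
    | @cons _ w _ hadj q =>
      subst hu hz
      rw [toSimpleGraph_adj_iff] at hadj
      obtain ⟨e, he⟩ := hadj
      refine ⟨e, w, he, ?_⟩
      have := SimpleGraph.dist_le q
      simp only [SimpleGraph.Walk.length_cons] at hp
      change T.toSimpleGraph.dist w _ < T.toSimpleGraph.dist _ _
      omega
  choose c w hcw hlt using hstep
  have hother (i : {i : V // i ≠ r}) : G.otherEnd (c i) i = w i :=
    ((hcw i).mono hTG.le).inc_left.isLink_otherEnd.right_unique ((hcw i).mono hTG.le)
  have hc : c ∈ G.rootedChoices r :=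
    ⟨fun i => ((hcw i).mono hTG.le).inc_left, h, fun i => by simpa only [hother] using hlt i⟩
  refine ⟨c, hc, ?_⟩
  -- The chosen edges already connect `T`. A tree is minimally connected, so they give every
  -- adjacency, and simplicity of `T` makes them all its edges.
  let H : SimpleGraph V(T) :=
    { Adj := fun x y => ∃ e ∈ Set.range c, T.IsLink e x y
      symm := ⟨fun x y ⟨e, he, hxy⟩ => ⟨e, he, hxy.symm⟩⟩
      loopless := ⟨fun x ⟨e, he, hxy⟩ => hxy.ne rfl⟩ }
  have hH : H.Connected := by
    have hr : ∀ v, H.Reachable ⟨v, mem v⟩ ⟨r, mem r⟩ := by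
      refine hc.2.induction (SimpleGraph.Reachable.refl _) fun i hi => ?_
      refine SimpleGraph.Reachable.trans (SimpleGraph.Adj.reachable ?_) hi
      exact ⟨c i, ⟨i, rfl⟩, by rw [hother]; exact hcw i⟩
    have : Nonempty V(T) := ⟨⟨r, mem r⟩⟩
    exact ⟨fun u v => (hr u).trans (hr v).symm⟩
  have hle : H ≤ T.toSimpleGraph := by
    rintro x y ⟨e, -, he⟩
    rw [toSimpleGraph_adj_iff]
    exact ⟨e, he⟩
  have hge := (SimpleGraph.isTree_iff_minimal_connected.1 htree).2 hH hle
  refine IsSpanningSubgraph.ext_of_edgeSet (G := T) ?_ ⟨?_, ?_⟩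
  · rw [edgeSet_restrict]
    ext e
    constructor
    · rintro ⟨-, i, rfl⟩
      exact (hcw i).edge_mem
    · intro he
      obtain ⟨x, y, hxy⟩ := exists_isLink_of_mem_edgeSet he
      have hadj : T.toSimpleGraph.Adj ⟨x, mem x⟩ ⟨y, mem y⟩ := by
        rw [toSimpleGraph_adj_iff]
        exact ⟨e, hxy⟩
      obtain ⟨f, hf, hfl⟩ := hge hadj
      exact ⟨hTG.le.edgeSet_mono he, hxy.eq hfl ▸ hf⟩
  · refine (Compatible.of_le_le (G := G) restrict_le hTG.le).le_iff.2 ⟨fun v _ => mem v, ?_⟩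
    rw [edgeSet_restrict]
    rintro e ⟨-, i, rfl⟩
    exact (hcw i).edge_mem
  · simp [hTG.vertexSet_eq]

lemma numSpanningTrees_eq_ncard_rootedChoices [Finite V] [G.Loopless] (hV : V(G) = Set.univ)
    (r : V) :
    G.numSpanningTrees = (G.rootedChoices r).ncard := by
  have himg : G.spanningTrees = (fun c => G.restrict (Set.range c)) '' G.rootedChoices r := by
    ext T
    constructor
    · exact exists_rootedChoice_of_mem_spanningTrees hV r
    · rintro ⟨c, hc, rfl⟩
      exact restrict_range_mem_spanningTrees hV hc
  rw [numSpanningTrees, himg, Set.InjOn.ncard_image]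
  intro c hc c' hc' h
  refine eq_of_range_subset_of_mem_rootedChoices hc hc' ?_
  rintro _ ⟨i, rfl⟩
  have : c i ∈ E(G.restrict (Set.range c)) := by
    rw [edgeSet_restrict]
    exact ⟨(hc.1 i).edge_mem, i, rfl⟩
  rw [show G.restrict (Set.range c) = G.restrict (Set.range c') from h, edgeSet_restrict] at this
  exact this.2

end

variable [DecidableEq V]

lemma laplacianMatrix_apply_eq_sum (hE : E(G).Finite) (i j : V) :
    G.laplacianMatrix i j = ∑ e ∈ (hE.subset (G.incidenceSet_subset_edgeSet i)).toFinset,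
      ((if i = j then 1 else 0) - if G.otherEnd e i = j then 1 else 0) := by
  classical
  set s := (hE.subset (G.incidenceSet_subset_edgeSet i)).toFinset with hs
  have hval : G.valence i = #s := Set.ncard_eq_toFinset_card _ _
  have hadj : {e | G.IsLink e i j}.ncard = #{e ∈ s | G.otherEnd e i = j} := by
    rw [← Set.ncard_coe_finset]
    congr 1
    ext e
    simp only [Set.mem_ofPred_eq, coe_filter, hs, Set.Finite.mem_toFinset, mem_incidenceSet]
    constructor
    · exact fun h => ⟨h.inc_left, h.inc_left.isLink_otherEnd.right_unique h⟩
    · rintro ⟨h, rfl⟩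
      exact h.isLink_otherEnd
  simp only [laplacianMatrix, Matrix.sub_apply, diagonal_apply, adjacencyMatrix, of_apply, hval,
    hadj, sum_sub_distrib, sum_boole]
  by_cases h : i = j <;> simp [h]

lemma isSymm_laplacianMatrix : G.laplacianMatrix.IsSymm := by
  refine (isSymm_diagonal _).sub ?_
  ext i j
  simp [adjacencyMatrix, isLink_comm]

variable [Fintype V]

lemma one_vecMul_laplacianMatrix (hE : E(G).Finite) : 1 ᵥ* G.laplacianMatrix = 0 := by
  rw [← isSymm_laplacianMatrix.eq, vecMul_transpose]
  ext i
  simp only [mulVec, dotProduct, Pi.one_apply, mul_one, Pi.zero_apply,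
    laplacianMatrix_apply_eq_sum hE]
  rw [sum_comm]
  simp

/-- The **matrix-tree theorem** for finite loopless multigraphs. -/
theorem det_laplacianMatrix_submatrix [G.Loopless] (hV : V(G) = Set.univ) (hE : E(G).Finite)
    (r : V) :
    (G.laplacianMatrix.submatrix Subtype.val Subtype.val :
      Matrix {i : V // i ≠ r} {i : V // i ≠ r} ℤ).det = G.numSpanningTrees := by
  classical
  let A (i : {i : V // i ≠ r}) : Finset E :=
    (hE.subset (G.incidenceSet_subset_edgeSet i)).toFinset
  have hrows : (G.laplacianMatrix.submatrix Subtype.val Subtype.val :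
      Matrix {i : V // i ≠ r} {i : V // i ≠ r} ℤ) = fun i => ∑ e ∈ A i,
        fun j : {i : V // i ≠ r} =>
          ((if (i : V) = j then 1 else 0) - if G.otherEnd e i = j then 1 else 0 : ℤ) := by
    ext i j
    rw [Finset.sum_apply]
    exact laplacianMatrix_apply_eq_sum hE i j
  have hdet (c : {i : V // i ≠ r} → E) :
      detRowAlternating (fun i : {i : V // i ≠ r} => fun j : {i : V // i ≠ r} =>
        ((if (i : V) = j then 1 else 0) - if G.otherEnd (c i) i = j then 1 else 0 : ℤ)) =
      if IsRooted (fun i => G.otherEnd (c i) i) then 1 else 0 := by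
    split_ifs with h
    · exact det_parentMatrix_of_isRooted h
    · exact det_parentMatrix_of_not_isRooted h
  rw [hrows]
  change detRowAlternating.toMultilinearMap _ = _
  rw [MultilinearMap.map_sum_finset]
  simp only [AlternatingMap.coe_multilinearMap, hdet, sum_boole]
  rw [numSpanningTrees_eq_ncard_rootedChoices hV r, ← Set.ncard_coe_finset]
  congr 2
  ext c
  simp [rootedChoices, A, Fintype.mem_piFinset]

lemma dvd_numSpanningTrees_mul [G.Loopless] (hV : V(G) = Set.univ) (hE : E(G).Finite) {r : V}
    {n : ℤ} {f x : V → ℤ} (hr : f r = 0) (hf : f ᵥ* G.laplacianMatrix = n • x) (i : V) :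
    n ∣ G.numSpanningTrees * f i := by
  by_cases hi : i = r
  · simp [hi, hr]
  set M : Matrix {i : V // i ≠ r} {i : V // i ≠ r} ℤ :=
    G.laplacianMatrix.submatrix Subtype.val Subtype.val with hM
  have hfM : (fun i : {i : V // i ≠ r} => f i) ᵥ* M = n • fun i : {i : V // i ≠ r} => x i := by
    ext j
    have := congrFun hf j
    simp only [vecMul, dotProduct] at this ⊢
    rw [Pi.smul_apply] at this ⊢
    rw [← this, ← Fintype.sum_subtype_add_sum_subtype (fun i => i ≠ r)]
    -- The deleted row has coefficient `f r = 0`.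
    refine left_eq_add.2 (sum_eq_zero fun k _ => ?_)
    rw [not_not.1 k.2, hr, zero_mul]
  have h := congrArg (· ᵥ* M.adjugate) hfM
  simp only [vecMul_vecMul, mul_adjugate, vecMul_smul, vecMul_one, smul_vecMul, hM,
    det_laplacianMatrix_submatrix hV hE r] at h
  have hi' := congrFun h ⟨i, hi⟩
  simp only [Pi.smul_apply, smul_eq_mul] at hi'
  exact ⟨_, hi'⟩

end MatrixTree

/-! ### Lattice elements as row combinations constant on parts -/

section Lattice

variable {V E : Type*} [Fintype V] [DecidableEq V] {G : Graph V E}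
  {P : Finpartition (univ : Finset V)}

lemma mem_laplacianLattice_iff {x : V → ℤ} :
    x ∈ G.laplacianLattice P ↔ ∃ a : Finset V → ℤ, ∑ S ∈ P.parts, a S • G.firingVector S = x := by
  have : {b | ∃ S ∈ P.parts, b = G.firingVector S} = G.firingVector '' P.parts := by
    ext b
    simp [eq_comm]
  rw [laplacianLattice, this, ← Submodule.span_int_eq_addSubgroupClosure,
    Submodule.mem_toAddSubgroup, Submodule.mem_span_image_finset_iff_exists_fun']

lemma sum_smul_firingVector (a : Finset V → ℤ) :
    ∑ S ∈ P.parts, a S • G.firingVector S = (fun i => a (P.part i)) ᵥ* G.laplacianMatrix := by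
  rw [vecMul_eq_sum]
  have h (F : V → V → ℤ) : ∑ i, F i = ∑ S ∈ P.parts, ∑ i ∈ S, F i := by
    conv_lhs => rw [← P.biUnion_parts, sum_biUnion P.disjoint]
    rfl
  rw [h]
  refine sum_congr rfl fun S hS => ?_
  refine smul_sum.trans (sum_congr rfl fun i hi => ?_)
  rw [P.part_eq_of_mem hS hi]

end Lattice

end Graph

theorem mainTheorem6 {V E E₁ : Type*} [Fintype V] [DecidableEq V]
    (G : Graph V E) (G₁ : Graph V E₁) (P : Finpartition (Finset.univ : Finset V))
    (hG : G.IsPargraph P) (hG₁ : G₁.IsPseudoPargraph P)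
    (hsame : G.SameLaplacianLattice G₁ P)
    (hcoprime : Nat.Coprime G.numSpanningTrees G₁.numSpanningTrees) :
    Module.Free ℤ (G.PicardGroup P) := by
  open Graph in
  have := hG.loopless
  have := hG₁.loopless
  obtain ⟨⟨r, -⟩⟩ := hG.connected.nonempty
  have hfin : Module.Finite ℤ (G.PicardGroup P) :=
    Module.Finite.of_surjective (QuotientAddGroup.mk' (G.laplacianLattice P)).toIntLinearMap
      (QuotientAddGroup.mk'_surjective _)
  suffices Module.IsTorsionFree ℤ (G.PicardGroup P) from
    Module.free_of_finite_type_torsion_free'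
  refine .of_smul_eq_zero fun n q hq => ?_
  induction q using QuotientAddGroup.induction_on with | _ x =>
  by_cases hn : n = 0
  · exact Or.inl hn
  right
  rw [← QuotientAddGroup.mk_zsmul, QuotientAddGroup.eq_zero_iff, mem_laplacianLattice_iff] at hq
  rw [QuotientAddGroup.eq_zero_iff, mem_laplacianLattice_iff]
  obtain ⟨a, ha⟩ := hq
  have hcongr (b : Finset V → ℤ) :
      ∑ S ∈ P.parts, b S • G₁.firingVector S = ∑ S ∈ P.parts, b S • G.firingVector S :=
    Finset.sum_congr rfl fun S hS => by rw [hsame S hS]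
  -- This shift makes the coefficient at `r` vanish and preserves the combination, because all the
  -- `b_S` sum to zero.
  set b : Finset V → ℤ := fun S => a S - a (P.part r) with hb
  have hbx : ∑ S ∈ P.parts, b S • G.firingVector S = n • x := by
    have h1 := sum_smul_firingVector (G := G) (P := P) fun _ => 1
    have h2 := one_vecMul_laplacianMatrix hG.finite_edgeSet
    rw [show (fun _ => 1 : V → ℤ) = 1 from rfl, h2] at h1
    simp only [one_smul] at h1
    simp only [hb, sub_smul, Finset.sum_sub_distrib, ← Finset.smul_sum, h1, smul_zero, sub_zero, ha]
  have hdvd (S : Finset V) (hS : S ∈ P.parts) : n ∣ b S := by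
    obtain ⟨i, hi⟩ := P.nonempty_of_mem_parts hS
    have h1 := dvd_numSpanningTrees_mul (f := fun i => b (P.part i)) (r := r) hG.vertexSet_eq
      hG.finite_edgeSet (by simp [hb]) ((sum_smul_firingVector b).symm.trans hbx) i
    have h2 := dvd_numSpanningTrees_mul (f := fun i => b (P.part i)) (r := r) hG₁.vertexSet_eq
      hG₁.finite_edgeSet (by simp [hb])
      ((sum_smul_firingVector b).symm.trans ((hcongr b).trans hbx)) i
    simp only [P.part_eq_of_mem hS hi] at h1 h2
    obtain ⟨u, v, huv⟩ := Nat.isCoprime_iff_coprime.2 hcoprime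
    have : b S = u * (G.numSpanningTrees * b S) + v * (G₁.numSpanningTrees * b S) := by
      linear_combination -(b S) * huv
    rw [this]
    exact dvd_add (h1.mul_left u) (h2.mul_left v)
  -- Since `n ≠ 0` and `ℤ^V` is torsion-free, the identity may be checked after multiplying by `n`.
  refine ⟨fun S => b S / n, smul_right_injective _ hn ?_⟩
  change n • ∑ S ∈ P.parts, (b S / n) • G.firingVector S = n • x
  rw [← hbx, Finset.smul_sum]
  refine Finset.sum_congr rfl fun S hS => ?_
  rw [smul_smul, Int.mul_ediv_cancel' (hdvd S hS)]
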